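/- Consider $\mathrm{PTLTL}^{FO}$ over linear integer arithmetic. Terms are $t ::= k_1x_1+\cdots+k_mx_m+c$ with $k_j,c\in\mathbb Z$ and integer variables $x_j$; formulae are $$\psi ::= p(t_1,\ldots,t_m)\mid t=u\mid t\le u\mid t\ge u\mid \psi\land\psi\mid\neg\psi\mid \mathbf X^{-1}\psi\mid \psi\,\mathbf S\,\psi\mid \forall(x_1,\ldots,x_n):p.\ \psi\quad(n\ge 1),$$ where $p$ ranges over uninterpreted predicate symbols on integers, each with a fixed arity. A history $h$ is a finite list $h_1,\ldots,h_{|h|}$ of sessions, a session being a finite set of events $p(c_1,\ldots,c_m)$ with $c_j\in\mathbb Z$. For $1\le i\le|h|$ and $\psi$ closed, $(h,i)\models\psi$ is defined by: $(h,i)\models p(\vec t)$ iff $p(\vec t\!\downarrow)\in h_i$, where $\vec t\!\downarrow$ are the values of $\vec t$; $=,\le,\ge,\land,\neg$ as usual; $(h,i)\models\mathbf X^{-1}\psi$ iff $i>1$ and $(h,i-1)\models\psi$; $(h,i)\models\psi_1\,\mathbf S\,\psi_2$ iff there is $1\le j\le i$ with $(h,j)\models\psi_2$ and $(h,k)\models\psi_1$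 for all $j<k\le i$; $(h,i)\models\forall\vec x:p.\ \psi$ iff $(h,i)\models\psi[\vec x:=\vec c]$ for all $\vec c$ with $p(\vec c)\in h_i$. A partially observable history $h$ is defined like a history, except that the arguments of its predicates are integer constants or variables; $V(h)$ is the finite set of variables occurring in $h$, and for $\sigma:V(h)\to\mathbb Z$, $h\sigma$ is the history obtained by substituting $\sigma$ in $h$. For a closed formula $\psi$ and $1\le i\le |h|$, $h$ potentially satisfies $\psi$ at $i$ if $(h\sigma,i)\models\psi$ for some $\sigma:V(h)\to\mathbb Z$, and $h$ adheres to $\psi$ at $i$ if $(h\sigma,i)\models\psi$ for all $\sigma:V(h)\to\mathbb Z$. Then both of the following problems are decidable: given a partially observable history $h$, an index $1\le i\le|h|$ and a closed formula $\psi$, decide (1) whether $h$ potentially satisfies $\psi$ at $i$; (2) whether $h$ adheres to $\psi$ at $i$. -/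

import Mathlib

namespace PTLTL

/-- A linear term `k₁ x₁ + ⋯ + kₘ xₘ + c` with integer coefficients, over the variables
`x₀, …, xₙ₋₁` (indexed by `Fin n`). -/
structure Term (n : ℕ) where
  /-- the monomials `kⱼ xⱼ` -/
  monomials : List (ℤ × Fin n)
  /-- the constant summand `c` -/
  const : ℤ

/-- The value `t↓` of a linear term under an assignment of integers to its variables. -/
def Term.eval {n : ℕ} (t : Term n) (ρ : Fin n → ℤ) : ℤ :=
  (t.monomials.map fun m => m.1 * ρ m.2).sum + t.const

/-- The interpreted relations: `=`, `≤`, `≥` on the integers. -/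
inductive Cmp where
  | eq
  | le
  | ge

/-- The standard interpretation of the relation symbols. -/
def Cmp.Holds : Cmp → ℤ → ℤ → Prop
  | .eq, a, b => a = b
  | .le, a, b => a ≤ b
  | .ge, a, b => a ≥ b

/-- Formulae of first-order past-time LTL with guarded quantifiers, over linear integer
arithmetic, whose free variables are among `x₀, …, xₙ₋₁`. Bound variables are nameless: a
quantifier over `k + 1 ≥ 1` variables at a place where `x₀, …, xₙ₋₁` are in scope binds
`xₙ, …, xₙ₊ₖ`. Thus `Formula 0` is the type of closed formulae up to renaming of bound variables.
An uninterpreted predicate symbol is determined by its name (a natural number) and its arity. -/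
inductive Formula : ℕ → Type where
  /-- `p(t₁, …, tₘ)` for an uninterpreted predicate symbol `p` of arity `m ≥ 0` -/
  | pred {n : ℕ} (p : ℕ) (ts : List (Term n)) : Formula n
  /-- `R(t, u)` for an interpreted relation `R` -/
  | rel {n : ℕ} (R : Cmp) (t u : Term n) : Formula n
  /-- conjunction -/
  | and {n : ℕ} (φ ψ : Formula n) : Formula n
  /-- negation -/
  | neg {n : ℕ} (φ : Formula n) : Formula n
  /-- `X⁻¹ φ`, "in the previous session" -/
  | prev {n : ℕ} (φ : Formula n) : Formula n
  /-- `φ S ψ`, "since" -/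
  | since {n : ℕ} (φ ψ : Formula n) : Formula n
  /-- `∀ (xₙ, …, xₙ₊ₖ) : p. φ`, for a predicate symbol `p` of arity `k + 1` -/
  | all {n : ℕ} (p k : ℕ) (φ : Formula (n + (k + 1))) : Formula n

/-- An event `p(c₁, …, cₘ)`: the name of an uninterpreted predicate symbol and the list of its
(integer) arguments. -/
abbrev Event := ℕ × List ℤ

/-- A session is a finite set of events. -/
abbrev Session := Finset Event

/-- A history is a finite list of sessions. -/
abbrev History := List Session

/-- The `i`-th session of a history, `1 ≤ i ≤ |h|` (sessions are numbered from `1`). -/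
def History.session (h : History) (i : ℕ) : Session := h.getD (i - 1) ∅

/-- The forcing relation `(h, i) ⊨ φ`, for `1 ≤ i ≤ |h|`, where `ρ` gives the values that have been
substituted for the free variables of `φ`. -/
def Formula.Sat (h : History) : {n : ℕ} → Formula n → ℕ → (Fin n → ℤ) → Prop
  | _, .pred p ts, i, ρ => ((p, ts.map fun t => t.eval ρ) : Event) ∈ h.session i
  | _, .rel R t u, _, ρ => R.Holds (t.eval ρ) (u.eval ρ)
  | _, .and φ ψ, i, ρ => φ.Sat h i ρ ∧ ψ.Sat h i ρ
  | _, .neg φ, i, ρ => ¬ φ.Sat h i ρ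
  | _, .prev φ, i, ρ => 1 < i ∧ φ.Sat h (i - 1) ρ
  | _, .since φ ψ, i, ρ =>
      ∃ j : ℕ, 1 ≤ j ∧ j ≤ i ∧ ψ.Sat h j ρ ∧ ∀ k : ℕ, j < k → k ≤ i → φ.Sat h k ρ
  | _, .all p k φ, i, ρ =>
      ∀ c : Fin (k + 1) → ℤ, ((p, List.ofFn c) : Event) ∈ h.session i → φ.Sat h i (Fin.append ρ c)

/-- `(h, i) ⊨ ψ` for a closed formula `ψ`. -/
def Forces (h : History) (i : ℕ) (ψ : Formula 0) : Prop := ψ.Sat h i Fin.elim0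

/-- An argument in a partially observable history: a constant `Sum.inl c` or a variable `Sum.inr x`,
variables being named by natural numbers. -/
abbrev POArg := ℤ ⊕ ℕ

/-- A predicate `p(u₁, …, uₘ)` whose arguments are constants or variables. -/
abbrev POEvent := ℕ × List POArg

/-- A partially observable session. -/
abbrev POSession := Finset POEvent

/-- A partially observable history. -/
abbrev POHistory := List POSession

/-- `V(h)`, the set of the variables that occur in `h`. -/
def POHistory.vars (h : POHistory) : Set ℕ :=
  {x | ∃ s ∈ h, ∃ e ∈ s, (Sum.inr x : POArg) ∈ e.2}

open Classical in
/-- The history `hσ`, for a substitution `σ` with domain `V(h)`. (The value `0` is never used, as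
all variables of `h` belong to `V(h)`.) -/
noncomputable def POHistory.subst (h : POHistory) (σ : h.vars → ℤ) : History :=
  h.map fun s => s.image fun e =>
    (e.1, e.2.map (Sum.elim id fun x => if hx : x ∈ h.vars then σ ⟨x, hx⟩ else 0))

/-- `h` potentially satisfies `ψ` at `i`. -/
def PotentiallySatisfies (h : POHistory) (i : ℕ) (ψ : Formula 0) : Prop :=
  ∃ σ : h.vars → ℤ, Forces (h.subst σ) i ψ

/-- `h` adheres to `ψ` at `i`. -/
def Adheres (h : POHistory) (i : ℕ) (ψ : Formula 0) : Prop :=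
  ∀ σ : h.vars → ℤ, Forces (h.subst σ) i ψ

/-! ### Formulae as inputs of algorithms -/

/-- A term as a piece of finite data: its monomials, with their variables as numbers, and its
constant. -/
def Term.data {n : ℕ} (t : Term n) : List (ℤ × ℕ) × ℤ :=
  (t.monomials.map fun m => (m.1, (m.2 : ℕ)), t.const)

/-- The number of a relation symbol. -/
def Cmp.code : Cmp → ℕ
  | .eq => 0
  | .le => 1
  | .ge => 2

/-- Gödel numbers of formulae. -/
def Formula.code : {n : ℕ} → Formula n → ℕ
  | _, .pred p ts => Nat.pair 0 (Encodable.encode (p, ts.map Term.data))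
  | _, .rel R t u => Nat.pair 1 (Encodable.encode (R.code, t.data, u.data))
  | _, .and φ ψ => Nat.pair 2 (Nat.pair φ.code ψ.code)
  | _, .neg φ => Nat.pair 3 φ.code
  | _, .prev φ => Nat.pair 4 φ.code
  | _, .since φ ψ => Nat.pair 5 (Nat.pair φ.code ψ.code)
  | _, .all p k φ => Nat.pair 6 (Nat.pair p (Nat.pair k φ.code))

theorem Term.data_injective {n : ℕ} : Function.Injective (Term.data : Term n → _) := by
  rintro ⟨m, c⟩ ⟨m', c'⟩ h
  simp only [Term.data, Prod.mk.injEq] at h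
  obtain ⟨h1, rfl⟩ := h
  have : Function.Injective fun m : ℤ × Fin n => (m.1, (m.2 : ℕ)) := by
    rintro ⟨a, b⟩ ⟨a', b'⟩ h
    simp only [Prod.mk.injEq] at h
    exact Prod.ext h.1 (Fin.ext h.2)
  rw [List.map_injective_iff.2 this h1]

theorem Cmp.code_injective : Function.Injective Cmp.code := by
  intro a b h
  cases a <;> cases b <;> simp_all [Cmp.code]

/-- Distinct formulae have distinct Gödel numbers. -/
theorem Formula.code_injective {n : ℕ} : Function.Injective (Formula.code : Formula n → ℕ) := by
  intro φ
  induction φ with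
  | pred p ts =>
    intro ψ h
    cases ψ <;> simp only [Formula.code, Nat.pair_eq_pair, Encodable.encode_inj, Prod.mk.injEq,
      true_and] at h <;>
      first
      | (obtain ⟨rfl, h⟩ := h; rw [List.map_injective_iff.2 Term.data_injective h])
      | omega
  | rel R t u =>
    intro ψ h
    cases ψ <;> simp only [Formula.code, Nat.pair_eq_pair, Encodable.encode_inj, Prod.mk.injEq,
      true_and] at h <;>
      first
      | (obtain ⟨h1, h2, h3⟩ := h
         rw [Cmp.code_injective h1, Term.data_injective h2, Term.data_injective h3])
      | omega
  | and φ χ ih1 ih2 =>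
    intro ψ h
    cases ψ <;> simp only [Formula.code, Nat.pair_eq_pair, true_and] at h <;>
      first
      | (rw [ih1 h.1, ih2 h.2])
      | omega
  | neg φ ih =>
    intro ψ h
    cases ψ <;> simp only [Formula.code, Nat.pair_eq_pair, true_and] at h <;>
      first
      | (rw [ih h])
      | omega
  | prev φ ih =>
    intro ψ h
    cases ψ <;> simp only [Formula.code, Nat.pair_eq_pair, true_and] at h <;>
      first
      | (rw [ih h])
      | omega
  | since φ χ ih1 ih2 =>
    intro ψ h
    cases ψ <;> simp only [Formula.code, Nat.pair_eq_pair, true_and] at h <;>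
      first
      | (rw [ih1 h.1, ih2 h.2])
      | omega
  | all p k φ ih =>
    intro ψ h
    cases ψ <;> simp only [Formula.code, Nat.pair_eq_pair, true_and] at h <;>
      first
      | (obtain ⟨rfl, rfl, h⟩ := h; rw [ih h])
      | omega

/-- A problem `P` about partially observable histories `h`, indices `1 ≤ i ≤ |h|` and closed
formulae `ψ` is decidable if there is one algorithm (a total recursive function) that decides
`P h i ψ` for all of these inputs. The algorithm is given `h` with each session as a list of its
elements (in any order, possibly with repetitions), the number `i`, and the Gödel number of `ψ`. -/
def DecidableProblem (P : POHistory → ℕ → Formula 0 → Prop) : Prop :=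
  ∃ f : List (List POEvent) × ℕ × ℕ → Bool, Computable f ∧
    ∀ (l : List (List POEvent)) (i : ℕ) (ψ : Formula 0), 1 ≤ i → i ≤ l.length →
      (f (l, i, ψ.code) = true ↔ P (l.map List.toFinset) i ψ)

end PTLTL

namespace PTLTL

/-! ### A small model property of linear integer arithmetic -/

/-! Adherence to `ψ` is the failure of potential satisfaction of `¬ψ`, so it suffices to decide the
existence of a satisfying assignment.

Guarded quantifiers range only over arguments of events in the history, so every value met while
evaluating `ψ` is a constant or variable of `h`. Hence each atomic test compares affine forms in the
variables of `h`, with coefficients bounded in terms of the codes of `h` and `ψ`. Two assignments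
giving the same signs to all such forms therefore satisfy the same formulae (`Formula.sat_congr`).

The arithmetic core is `exists_small_model`: every integer point has the same signs, for forms with
coefficients at most `N`, as a point of computably bounded size. It is a quantitative form of
quantifier elimination for Presburger arithmetic, one coordinate at a time. Multiplying by `L = N!`
turns each condition on the last coordinate `y` into a comparison of `L * y` with a form in the
earlier coordinates. The new `L * y'` is placed above the transferred value of the largest form not
exceeding `L * y`, at a small distance in the right residue class (`exists_last_coordinate`).

So a finite search suffices (`exists_bounded_assignment`). Each candidate is tested by a primitive
recursive evaluator that fills a table of satisfying points in the order of Gödel numbers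
(`codeHolds_tables_iff`). -/

/-- The value of the affine form `∑ i < n, aᵢ xᵢ + c`. -/
def affine (n : ℕ) (a : ℕ → ℤ) (c : ℤ) (x : ℕ → ℤ) : ℤ :=
  ∑ i ∈ Finset.range n, a i * x i + c

/-- The coefficients of an affine form in `n` variables are bounded by `N`. -/
def CoeffBound (n : ℕ) (N : ℤ) (a : ℕ → ℤ) (c : ℤ) : Prop :=
  (∀ i < n, |a i| ≤ N) ∧ |c| ≤ N

/-- Two points cannot be told apart by the signs of affine forms with coefficients at most `N`. -/
def SameSigns (n : ℕ) (N : ℤ) (x y : ℕ → ℤ) : Prop :=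
  ∀ a c, CoeffBound n N a c → (0 ≤ affine n a c x ↔ 0 ≤ affine n a c y)

theorem affine_sub (n : ℕ) (a b : ℕ → ℤ) (c d : ℤ) (x : ℕ → ℤ) :
    affine n (fun i => a i - b i) (c - d) x = affine n a c x - affine n b d x := by
  simp only [affine, sub_mul, Finset.sum_sub_distrib]
  ring

theorem affine_smul (n : ℕ) (k : ℤ) (a : ℕ → ℤ) (c : ℤ) (x : ℕ → ℤ) :
    affine n (fun i => k * a i) (k * c) x = k * affine n a c x := by
  simp only [affine, mul_add, Finset.mul_sum, mul_assoc]

theorem affine_sub_const (n : ℕ) (a : ℕ → ℤ) (c d : ℤ) (x : ℕ → ℤ) :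
    affine n a (c - d) x = affine n a c x - d := by
  simp only [affine]
  ring

theorem CoeffBound.mono {n : ℕ} {N N' : ℤ} {a : ℕ → ℤ} {c : ℤ} (h : CoeffBound n N a c)
    (hN : N ≤ N') : CoeffBound n N' a c :=
  ⟨fun i hi => (h.1 i hi).trans hN, h.2.trans hN⟩

theorem CoeffBound.sub {n : ℕ} {N N' : ℤ} {a b : ℕ → ℤ} {c d : ℤ} (h : CoeffBound n N a c)
    (h' : CoeffBound n N' b d) : CoeffBound n (N + N') (fun i => a i - b i) (c - d) :=
  ⟨fun i hi => (abs_sub _ _).trans (add_le_add (h.1 i hi) (h'.1 i hi)),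
    (abs_sub _ _).trans (add_le_add h.2 h'.2)⟩

theorem CoeffBound.smul {n : ℕ} {N k K : ℤ} {a : ℕ → ℤ} {c : ℤ} (h : CoeffBound n N a c)
    (hk : |k| ≤ K) : CoeffBound n (K * N) (fun i => k * a i) (k * c) := by
  have hK : 0 ≤ K := (abs_nonneg k).trans hk
  constructor
  · intro i hi
    rw [abs_mul]
    exact mul_le_mul hk (h.1 i hi) (abs_nonneg _) hK
  · rw [abs_mul]
    exact mul_le_mul hk h.2 (abs_nonneg _) hK

theorem CoeffBound.sub_const {n : ℕ} {N N' : ℤ} {a : ℕ → ℤ} {c d : ℤ} (h : CoeffBound n N a c)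
    (hN : 0 ≤ N') (h' : |d| ≤ N') : CoeffBound n (N + N') a (c - d) :=
  ⟨fun i hi => (h.1 i hi).trans (by omega),
    (abs_sub _ _).trans (add_le_add h.2 h')⟩

theorem SameSigns.mono {n : ℕ} {N N' : ℤ} {x y : ℕ → ℤ} (h : SameSigns n N' x y) (hN : N ≤ N') :
    SameSigns n N x y :=
  fun a c hac => h a c (hac.mono hN)

/-- A comparison is the sign of a difference, whose coefficients may be twice as large; hence the
doubled bound. -/
theorem SameSigns.le_iff {n : ℕ} {N : ℤ} {x y : ℕ → ℤ} (h : SameSigns n (N + N) x y)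
    {a b : ℕ → ℤ} {c d : ℤ} (hac : CoeffBound n N a c) (hbd : CoeffBound n N b d) :
    affine n a c x ≤ affine n b d x ↔ affine n a c y ≤ affine n b d y := by
  have := h _ _ (hbd.sub hac)
  rwa [affine_sub, affine_sub, sub_nonneg, sub_nonneg] at this

theorem dvd_affine_sub {n : ℕ} {Q : ℤ} {x y : ℕ → ℤ} (h : ∀ i < n, Q ∣ x i - y i) (a : ℕ → ℤ)
    (c : ℤ) : Q ∣ affine n a c x - affine n a c y := by
  have : affine n a c x - affine n a c y = ∑ i ∈ Finset.range n, a i * (x i - y i) := by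
    simp only [affine, mul_sub, Finset.sum_sub_distrib]
    ring
  rw [this]
  exact Finset.dvd_sum fun i hi => (h i (Finset.mem_range.1 hi)).mul_left _

theorem abs_affine_le {n : ℕ} {N b : ℤ} {a x : ℕ → ℤ} {c : ℤ} (h : CoeffBound n N a c)
    (hx : ∀ i < n, |x i| ≤ b) : |affine n a c x| ≤ N * (n * b + 1) := by
  have h0 : 0 ≤ N := (abs_nonneg c).trans h.2
  have h1 : |∑ i ∈ Finset.range n, a i * x i| ≤ ∑ i ∈ Finset.range n, N * b := by
    refine (Finset.abs_sum_le_sum_abs _ _).trans (Finset.sum_le_sum fun i hi => ?_)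
    have hi := Finset.mem_range.1 hi
    rw [abs_mul]
    exact mul_le_mul (h.1 i hi) (hx i hi) (abs_nonneg _) h0
  rw [Finset.sum_const, Finset.card_range, nsmul_eq_mul] at h1
  calc |affine n a c x| ≤ _ := abs_add_le _ _
    _ ≤ n * (N * b) + N := add_le_add h1 h.2
    _ = N * (n * b + 1) := by ring

/-- Shortens the gap between `L * y` and the nearest form below it. For positive `r` the residue is
taken in `1, …, Q` rather than `0, …, Q - 1`, so that a strict gap stays strict. -/
theorem exists_small_residue {Q r : ℤ} (hQ : 0 < Q) (hr : 0 ≤ r) :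
    ∃ r', Q ∣ r - r' ∧ 0 ≤ r' ∧ r' ≤ r ∧ r' ≤ Q ∧ (0 < r → 0 < r') := by
  rcases hr.eq_or_lt with rfl | hr
  · exact ⟨0, by simp, le_rfl, le_rfl, hQ.le, id⟩
  · have h1 := Int.emod_nonneg (r - 1) hQ.ne'
    have h2 := Int.emod_lt_of_pos (r - 1) hQ
    have h3 := Int.mul_ediv_add_emod (r - 1) Q
    have h4 : 0 ≤ Q * ((r - 1) / Q) := mul_nonneg hQ.le (Int.ediv_nonneg (by omega) hQ.le)
    exact ⟨(r - 1) % Q + 1, ⟨(r - 1) / Q, by omega⟩, by omega, by omega, by omega, by omega⟩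

/-- The coefficient bound needed in `n` variables to handle coefficients up to `N` in `n + 1`
variables. -/
def boundStep (N : ℕ) : ℕ := 4 * (N.factorial * N)

theorem le_boundStep (N : ℕ) : N ≤ boundStep N := by
  have := Nat.factorial_pos N
  unfold boundStep
  nlinarith

/-- Only the position of `L * y` among the values of forms with coefficients at most `L * N`, and
its residue modulo `L * N`, matter. Both can be reproduced over `x'` by a point close to one of the
transferred values. -/
theorem exists_last_coordinate_of_nonneg {n N : ℕ} (hN : 1 ≤ N) {x x' : ℕ → ℤ} {b : ℤ}
    (hs : SameSigns n (boundStep N) x x') (hd : ∀ i < n, (boundStep N : ℤ) ∣ x i - x' i)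
    (hb : ∀ i < n, |x' i| ≤ b) (hb0 : 0 ≤ b) {y : ℤ} (hy : 0 ≤ y) :
    ∃ y' : ℤ, (N : ℤ) ∣ y - y' ∧ |y'| ≤ boundStep N * (n * b + 1) ∧
      ∀ a c k, CoeffBound n N a c → |k| ≤ (N : ℤ) →
        (0 ≤ affine n a c x + k * y ↔ 0 ≤ affine n a c x' + k * y') := by
  set L : ℤ := (N.factorial : ℤ) with hL
  have hL1 : 1 ≤ L := Int.natCast_pos.2 (Nat.factorial_pos N)
  have hN' : (1 : ℤ) ≤ N := by exact_mod_cast hN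
  have hK : (boundStep N : ℤ) = 4 * (L * N) := by simp [boundStep, hL]
  set Q : ℤ := L * N with hQ
  have hQ1 : 1 ≤ Q := by nlinarith
  rw [hK] at hs hd ⊢
  have hs2 : SameSigns n (Q + Q) x x' := hs.mono (by omega)
  -- The largest form value below `L * y`; as `y ≥ 0`, the zero form is a competitor, so one exists.
  obtain ⟨s, ⟨⟨a₀, c₀, hac, rfl⟩, hle⟩, hmax⟩ := Int.exists_greatest_of_bdd
    (P := fun s => (∃ a c, CoeffBound n Q a c ∧ affine n a c x = s) ∧ s ≤ L * y)
    ⟨L * y, fun z hz => hz.2⟩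
    ⟨0, ⟨fun _ => 0, 0, ⟨fun i _ => by simp; omega, by simp; omega⟩, by simp [affine]⟩,
      mul_nonneg (by omega) hy⟩
  set s := affine n a₀ c₀ x
  set s' := affine n a₀ c₀ x' with hs'
  obtain ⟨r', hr1, hr2, hr3, hr4, hr5⟩ := exists_small_residue (Q := Q) (r := L * y - s)
    (by omega) (by omega)
  have hQs : Q ∣ s - s' :=
    dvd_affine_sub (fun i hi => (Dvd.intro_left 4 rfl).trans (hd i hi)) _ _
  have hQy : Q ∣ L * y - (s' + r') := by
    have := dvd_add hQs hr1
    rwa [show s - s' + (L * y - s - r') = L * y - (s' + r') by ring] at this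
  -- The point `s' + r'` is congruent to `L * y` modulo `Q`, a multiple of `L`, so it can be divided
  -- by `L`.
  obtain ⟨y', hy'⟩ : L ∣ s' + r' := by
    have h1 : L ∣ L * y - (s' + r') := (Dvd.intro _ rfl).trans hQy
    have := dvd_sub (Dvd.intro y rfl : L ∣ L * y) h1
    simpa using this
  -- comparisons of the new coordinate with the values of affine forms
  have key1 : ∀ a c, CoeffBound n Q a c → (affine n a c x ≤ L * y ↔ affine n a c x' ≤ L * y') := by
    intro a c h
    constructor
    · intro h1
      have := (hs2.le_iff h hac).1 (hmax _ ⟨⟨a, c, h, rfl⟩, h1⟩)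
      omega
    · intro h1
      by_contra h2
      -- A form exceeding `L * y` exceeds `s` by at least `r' + 1`, since `r'` is at most the old
      -- gap; this transfers to `x'`. The difference of two forms costs `2 * Q` and the constant `r'
      -- + 1` at most another `2 * Q`, whence the factor 4 in `boundStep`.
      have h3 := (hs _ _ (((h.sub hac).sub_const (d := r' + 1) (N' := Q + Q) (by omega)
        (by rw [abs_of_nonneg] <;> omega)).mono (by omega)))
      rw [affine_sub_const _ _ _ (r' + 1), affine_sub_const _ _ _ (r' + 1), affine_sub,
        affine_sub] at h3
      have := h3.1 (by omega)
      omega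
  have key2 : ∀ a c, CoeffBound n Q a c → (L * y ≤ affine n a c x ↔ L * y' ≤ affine n a c x') := by
    intro a c h
    have h1 := hs2.le_iff h hac
    have h2 := hs2.le_iff hac h
    have h3 := key1 a c h
    have h4 : affine n a c x ≤ L * y → affine n a c x ≤ s := fun h1 => hmax _ ⟨⟨a, c, h, rfl⟩, h1⟩
    -- With a positive gap no form equals `L * y` or `L * y'`, so this reduces to `key1`. Otherwise
    -- `r' = 0`, and both sides compare forms with `s` and `s'`.
    by_cases h0 : 0 < L * y - s
    · have := hr5 h0
      constructor <;> intro h5 <;> by_contra h6 <;> omega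
    · constructor <;> intro h5 <;> by_contra h6 <;> omega
  refine ⟨y', ?_, ?_, ?_⟩
  · rw [hy', ← mul_sub] at hQy
    exact Int.dvd_of_mul_dvd_mul_left (by omega) hQy
  · have h1 : |s'| ≤ Q * (n * b + 1) := abs_affine_le hac hb
    have h2 : |L * y'| ≤ Q * (n * b + 1) + Q := by
      rw [← hy']
      refine (abs_add_le _ _).trans (add_le_add h1 ?_)
      rwa [abs_of_nonneg hr2]
    have h3 : |y'| ≤ |L * y'| := by
      rw [abs_mul, abs_of_nonneg (by omega : 0 ≤ L)]
      nlinarith [abs_nonneg y']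
    have h4 : 0 ≤ Q * (n * b) := by positivity
    nlinarith
  · intro a c k h hk
    -- A nonzero `k` with `|k| ≤ N` divides `L = N!`, so multiplying by `L / |k|` turns the sign of
    -- `t + k * y` into a comparison of a form with `L * y`.
    rcases lt_trichotomy k 0 with hk0 | rfl | hk0
    · obtain ⟨m, hm⟩ : -k ∣ L := by
        have : (-k).toNat ∣ N.factorial := Nat.dvd_factorial (by omega) (by
          rw [abs_le] at hk
          omega)
        have := Int.natCast_dvd_natCast.2 this
        rwa [Int.toNat_of_nonneg (by omega)] at this
      have hm0 : 0 < m := by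
        by_contra h0
        nlinarith
      have hmL : |m| ≤ L := by
        rw [abs_of_pos hm0]
        nlinarith
      have := key2 _ _ (h.smul hmL)
      rw [affine_smul, affine_smul] at this
      have e : ∀ t z : ℤ, (L * z ≤ m * t ↔ 0 ≤ t + k * z) := by
        intro t z
        rw [hm, show m * t = m * (t + k * z) + -k * m * z by ring, le_add_iff_nonneg_left,
          mul_nonneg_iff_of_pos_left hm0]
      rwa [e, e] at this
    · simpa using hs a c (h.mono (by nlinarith))
    · obtain ⟨m, hm⟩ : k ∣ L := by
        have : k.toNat ∣ N.factorial := Nat.dvd_factorial (by omega) (by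
          rw [abs_le] at hk
          omega)
        have := Int.natCast_dvd_natCast.2 this
        rwa [Int.toNat_of_nonneg (by omega)] at this
      have hm0 : 0 < m := by
        by_contra h0
        nlinarith
      have hmL : |-m| ≤ L := by
        rw [abs_neg, abs_of_pos hm0]
        nlinarith
      have := key1 _ _ (h.smul hmL)
      rw [affine_smul, affine_smul] at this
      have e : ∀ t z : ℤ, (-m * t ≤ L * z ↔ 0 ≤ t + k * z) := by
        intro t z
        rw [hm, show k * m * z = m * (t + k * z) + -m * t by ring, le_add_iff_nonneg_left,
          mul_nonneg_iff_of_pos_left hm0]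
      rwa [e, e] at this

/-- A negative `y` is handled by changing the signs of both `y` and `k`. -/
theorem exists_last_coordinate {n N : ℕ} (hN : 1 ≤ N) {x x' : ℕ → ℤ} {b : ℤ}
    (hs : SameSigns n (boundStep N) x x') (hd : ∀ i < n, (boundStep N : ℤ) ∣ x i - x' i)
    (hb : ∀ i < n, |x' i| ≤ b) (hb0 : 0 ≤ b) (y : ℤ) :
    ∃ y' : ℤ, (N : ℤ) ∣ y - y' ∧ |y'| ≤ boundStep N * (n * b + 1) ∧
      ∀ a c k, CoeffBound n N a c → |k| ≤ (N : ℤ) →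
        (0 ≤ affine n a c x + k * y ↔ 0 ≤ affine n a c x' + k * y') := by
  rcases le_total 0 y with hy | hy
  · exact exists_last_coordinate_of_nonneg hN hs hd hb hb0 hy
  · obtain ⟨y', h1, h2, h3⟩ :=
      exists_last_coordinate_of_nonneg hN hs hd hb hb0 (neg_nonneg.2 hy)
    refine ⟨-y', ?_, by rwa [abs_neg], fun a c k h hk => ?_⟩
    · rw [← dvd_neg]
      rwa [show -(y - -y') = -y - y' by ring]
    · have := h3 a c (-k) h (by rwa [abs_neg])
      simpa using this

/-- A bound for the size of small models, in terms of the number `m` of variables and a bound `T`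
for the intermediate coefficients. -/
def modelBound (T m n : ℕ) : ℕ := (fun b => T * (m * b + 1))^[n] 0

theorem modelBound_succ (T m n : ℕ) :
    modelBound T m (n + 1) = T * (m * modelBound T m n + 1) :=
  Function.iterate_succ_apply' _ _ _

/-- Every integer point is indistinguishable, by affine forms with coefficients at most `N`, from a
point of bounded size. -/
theorem exists_small_model (n : ℕ) : ∀ {N T m : ℕ}, 1 ≤ N → boundStep^[n] N ≤ T → n ≤ m →
    ∀ x : ℕ → ℤ, ∃ x' : ℕ → ℤ, SameSigns n N x x' ∧ (∀ i < n, (N : ℤ) ∣ x i - x' i) ∧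
      ∀ i < n, |x' i| ≤ (modelBound T m n : ℤ) := by
  induction n with
  | zero =>
    intro N T m _ _ _ x
    exact ⟨x, fun a c _ => Iff.rfl, by simp, by simp⟩
  | succ n ih =>
    intro N T m hN hT hm x
    rw [Function.iterate_succ_apply] at hT
    have hstep : boundStep N ≤ T :=
      (Function.id_le_iterate_of_id_le le_boundStep n (boundStep N)).trans hT
    have hNs := le_boundStep N
    -- The earlier coordinates must already be correct for the larger bound `boundStep N`, which is
    -- why the induction is uniform in `N`.
    obtain ⟨x', h1, h2, h3⟩ := ih (hN.trans hNs) hT (by omega : n ≤ m) x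
    obtain ⟨y, h4, h5, h6⟩ := exists_last_coordinate hN h1 h2 h3 (by positivity) (x n)
    have hne : ∀ i < n, (if i = n then y else x' i) = x' i := fun i hi => if_neg hi.ne
    have haff : ∀ a c, affine (n + 1) a c (fun i => if i = n then y else x' i) =
        affine n a c x' + a n * y := by
      intro a c
      simp only [affine, Finset.sum_range_succ, if_true]
      rw [Finset.sum_congr rfl fun i hi => by rw [hne i (Finset.mem_range.1 hi)]]
      ring
    have haff' : ∀ a c, affine (n + 1) a c x = affine n a c x + a n * x n := by
      intro a c
      simp only [affine, Finset.sum_range_succ]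
      ring
    refine ⟨fun i => if i = n then y else x' i, ?_, ?_, ?_⟩
    · intro a c h
      rw [haff, haff']
      exact h6 a c (a n) ⟨fun i hi => h.1 i (by omega), h.2⟩ (h.1 n (by omega))
    · intro i hi
      rcases Nat.lt_succ_iff_lt_or_eq.1 hi with hi | rfl
      · simp only [hne i hi]
        exact (Int.natCast_dvd_natCast.2 ⟨4 * N.factorial, by unfold boundStep; ring⟩).trans
          (h2 i hi)
      · simpa using h4
    · intro i hi
      rw [modelBound_succ]
      rcases Nat.lt_succ_iff_lt_or_eq.1 hi with hi | rfl
      · simp only [hne i hi]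
        refine (h3 i hi).trans ?_
        have hm1 : 1 ≤ m := by omega
        have hT1 : 1 ≤ T := by omega
        have : modelBound T m n ≤ T * (m * modelBound T m n + 1) := by
          calc modelBound T m n ≤ m * modelBound T m n + 1 := by nlinarith
            _ ≤ T * _ := Nat.le_mul_of_pos_left _ hT1
        exact_mod_cast this
      · simp only [if_true]
        refine h5.trans ?_
        have : boundStep N * (i * modelBound T m i + 1) ≤ T * (m * modelBound T m i + 1) :=
          Nat.mul_le_mul hstep (by gcongr; omega)
        exact_mod_cast this

/-! ### Invariance of the forcing relation -/

/-- `f` is given by an affine form in `n` variables with coefficients at most `N`. -/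
def IsAffine (n : ℕ) (N : ℤ) (f : (ℕ → ℤ) → ℤ) : Prop :=
  ∃ a c, CoeffBound n N a c ∧ ∀ x, f x = affine n a c x

theorem IsAffine.mono {n : ℕ} {N N' : ℤ} {f : (ℕ → ℤ) → ℤ} (h : IsAffine n N f) (hN : N ≤ N') :
    IsAffine n N' f := by
  obtain ⟨a, c, h, hf⟩ := h
  exact ⟨a, c, h.mono hN, hf⟩

theorem isAffine_const (n : ℕ) {N c : ℤ} (h : |c| ≤ N) : IsAffine n N fun _ => c :=
  ⟨fun _ => 0, c, ⟨fun _ _ => by simpa using (abs_nonneg c).trans h, h⟩, fun x => by simp [affine]⟩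

theorem isAffine_var {n v : ℕ} {N : ℤ} (hv : v < n) (hN : 1 ≤ N) : IsAffine n N fun x => x v := by
  refine ⟨Pi.single v 1, 0, ⟨fun i _ => ?_, by simp; omega⟩, fun x => ?_⟩
  · by_cases h : i = v
    · subst h
      simpa using hN
    · simp [h]
      omega
  · simp [affine, Pi.single_apply, hv]

theorem IsAffine.add_smul {n : ℕ} {N N' k K : ℤ} {f g : (ℕ → ℤ) → ℤ} (hf : IsAffine n N f)
    (hk : |k| ≤ K) (hg : IsAffine n N' g) : IsAffine n (K * N + N') fun x => k * f x + g x := by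
  obtain ⟨a, c, h, hf⟩ := hf
  obtain ⟨b, d, h', hg⟩ := hg
  have h'' := h'.smul (k := -1) (K := 1) (by simp)
  refine ⟨_, _, ((h.smul hk).sub h'').mono (by simp), fun x => ?_⟩
  beta_reduce
  rw [affine_sub, affine_smul, affine_smul, hf, hg]
  ring

theorem SameSigns.le_iff_le {n : ℕ} {N : ℤ} {x y : ℕ → ℤ} (h : SameSigns n (N + N) x y)
    {f g : (ℕ → ℤ) → ℤ} (hf : IsAffine n N f) (hg : IsAffine n N g) : f x ≤ g x ↔ f y ≤ g y := by
  obtain ⟨a, c, h1, hf⟩ := hf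
  obtain ⟨b, d, h2, hg⟩ := hg
  rw [hf, hf, hg, hg, h.le_iff h1 h2]

theorem SameSigns.eq_iff_eq {n : ℕ} {N : ℤ} {x y : ℕ → ℤ} (h : SameSigns n (N + N) x y)
    {f g : (ℕ → ℤ) → ℤ} (hf : IsAffine n N f) (hg : IsAffine n N g) : f x = g x ↔ f y = g y := by
  rw [le_antisymm_iff, le_antisymm_iff, h.le_iff_le hf hg, h.le_iff_le hg hf]

/-! ### Codes as bounds for sizes -/

theorem encode_le_of_mem {α : Type*} [Encodable α] {a : α} {l : List α} (h : a ∈ l) :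
    Encodable.encode a < Encodable.encode l := by
  induction l with
  | nil => simp at h
  | cons b l ih =>
    rw [Encodable.encode_list_cons, Nat.lt_succ_iff]
    rcases List.mem_cons.1 h with rfl | h
    · exact Nat.left_le_pair _ _
    · exact (ih h).le.trans (Nat.right_le_pair _ _)

theorem length_le_encode {α : Type*} [Encodable α] (l : List α) :
    l.length ≤ Encodable.encode l := by
  induction l with
  | nil => simp
  | cons b l ih =>
    rw [Encodable.encode_list_cons, List.length_cons]
    exact Nat.succ_le_succ (ih.trans (Nat.right_le_pair _ _))

theorem encode_int_natCast (n : ℕ) : Encodable.encode (n : ℤ) = 2 * n := rfl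

theorem encode_int_negSucc (n : ℕ) : Encodable.encode (Int.negSucc n) = 2 * n + 1 := rfl

theorem abs_le_encode (z : ℤ) : |z| ≤ (Encodable.encode z : ℤ) := by
  rcases z with n | n
  · rw [Int.ofNat_eq_natCast, encode_int_natCast, abs_of_nonneg] <;> omega
  · rw [encode_int_negSucc, Int.negSucc_eq, abs_neg, abs_of_nonneg] <;> omega

/-- The coefficients and the length of a term are bounded by its code. -/
theorem Term.bounds {m C : ℕ} {t : Term m} (h : Encodable.encode t.data ≤ C) :
    t.monomials.length ≤ C ∧ (∀ q ∈ t.monomials, |q.1| ≤ (C : ℤ)) ∧ |t.const| ≤ (C : ℤ) := by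
  rw [Term.data, Encodable.encode_prod_val] at h
  have h1 := (Nat.left_le_pair _ _).trans h
  have h2 := (Nat.right_le_pair _ _).trans h
  refine ⟨?_, fun q hq => ?_, ?_⟩
  · have := length_le_encode (t.monomials.map fun m => (m.1, (m.2 : ℕ)))
    rw [List.length_map] at this
    exact this.trans h1
  · have h3 := encode_le_of_mem (List.mem_map_of_mem (f := fun m => (m.1, (m.2 : ℕ))) hq)
    rw [Encodable.encode_prod_val] at h3
    have h4 := (Nat.left_le_pair _ _).trans (h3.le.trans h1)
    exact (abs_le_encode _).trans (by exact_mod_cast h4)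
  · exact (abs_le_encode _).trans (by exact_mod_cast h2)

/-- The value of an argument under an assignment. -/
def argVal (x : ℕ → ℤ) : POArg → ℤ := Sum.elim id x

/-- The bound for the coefficients of terms of code at most `C` whose variables have been replaced
by affine forms with coefficients at most `A`. -/
def coeffBound (A C : ℕ) : ℕ := C * C * A + C + A

theorem isAffine_monomials {n m A C : ℕ} {ρ : Fin m → POArg}
    (hρ : ∀ j, IsAffine n A fun x => argVal x (ρ j)) (l : List (ℤ × Fin m))
    (hl : ∀ q ∈ l, |q.1| ≤ (C : ℤ)) :
    IsAffine n (l.length * (C * A) : ℕ) fun x => (l.map fun q => q.1 * argVal x (ρ q.2)).sum := by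
  induction l with
  | nil => simpa using isAffine_const n (c := 0) (N := 0) (by simp)
  | cons q l ih =>
    have h1 := (hρ q.2).add_smul (hl q (by simp)) (ih fun q hq => hl q (by simp [hq]))
    simp only [List.map_cons, List.sum_cons]
    refine h1.mono ?_
    push_cast [List.length_cons]
    linarith

theorem Term.isAffine {n m A C : ℕ} {t : Term m} (h : Encodable.encode t.data ≤ C)
    {ρ : Fin m → POArg} (hρ : ∀ j, IsAffine n A fun x => argVal x (ρ j)) :
    IsAffine n (coeffBound A C) fun x => t.eval fun j => argVal x (ρ j) := by
  obtain ⟨h1, h2, h3⟩ := Term.bounds h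
  have h4 := (isAffine_monomials hρ _ h2).add_smul (k := 1) (K := 1) (by simp)
    (isAffine_const n h3)
  simp only [one_mul] at h4
  refine h4.mono ?_
  have : t.monomials.length * (C * A) ≤ C * (C * A) := Nat.mul_le_mul_right _ h1
  have : t.monomials.length * (C * A) + C ≤ coeffBound A C := by
    unfold coeffBound
    nlinarith
  exact_mod_cast this

/-- A session under an assignment. -/
def instSession (x : ℕ → ℤ) (s : POSession) : Session :=
  s.image fun e => (e.1, e.2.map (argVal x))

theorem session_map_instSession (x : ℕ → ℤ) (h : POHistory) (i : ℕ) :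
    History.session (h.map (instSession x)) i = instSession x (h.getD (i - 1) ∅) := by
  rw [History.session, show (∅ : Session) = instSession x ∅ from rfl, List.getD_map]

theorem mem_instSession {x : ℕ → ℤ} {s : POSession} {p : ℕ} {l : List ℤ} :
    (p, l) ∈ instSession x s ↔ ∃ u : List POArg, (p, u) ∈ s ∧ u.map (argVal x) = l := by
  simp [instSession]

/-- Reindexes a guarded quantifier by the uninstantiated events, so that its range no longer depends
on the assignment. -/
theorem forall_mem_instSession {x : ℕ → ℤ} {s : POSession} {p k : ℕ} {P : (Fin k → ℤ) → Prop} :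
    (∀ c : Fin k → ℤ, ((p, List.ofFn c) : Event) ∈ instSession x s → P c) ↔
      ∀ u : Fin k → POArg, ((p, List.ofFn u) : POEvent) ∈ s → P fun j => argVal x (u j) := by
  simp only [mem_instSession]
  constructor
  · intro h u hu
    exact h _ ⟨_, hu, by rw [List.map_ofFn]; rfl⟩
  · rintro h c ⟨u, hu, huc⟩
    have hlen : u.length = k := by simpa using congrArg List.length huc
    subst hlen
    have := h u.get (by rwa [List.ofFn_get])
    convert this using 1
    apply List.ofFn_injective
    rw [← huc]
    conv_lhs => rw [← List.ofFn_get u, List.map_ofFn]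
    rfl

theorem map_eq_map_iff_congr {α β γ : Type*} {l : List α} {l' : List β} {f f' : α → γ}
    {g g' : β → γ} (h : ∀ a ∈ l, ∀ b ∈ l', (f a = g b ↔ f' a = g' b)) :
    l.map f = l'.map g ↔ l.map f' = l'.map g' := by
  induction l generalizing l' with
  | nil => cases l' <;> simp
  | cons a l ih =>
    cases l' with
    | nil => simp
    | cons b l' =>
      simp only [List.map_cons, List.cons.injEq]
      rw [h a (by simp) b (by simp), ih fun a ha b hb => h a (by simp [ha]) b (by simp [hb])]

/-- Assignments that agree on the signs of all relevant affine forms force the same formulae. -/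
theorem Formula.sat_congr {h : POHistory} {n A C : ℕ}
    (hh : ∀ s ∈ h, ∀ e ∈ s, ∀ u ∈ e.2, IsAffine n A fun x => argVal x u) {x y : ℕ → ℤ}
    (hxy : SameSigns n (coeffBound A C + coeffBound A C) x y) {m : ℕ} (φ : Formula m)
    (hφ : φ.code ≤ C) (i : ℕ) (ρ : Fin m → POArg)
    (hρ : ∀ j, IsAffine n A fun x => argVal x (ρ j)) :
    φ.Sat (h.map (instSession x)) i (fun j => argVal x (ρ j)) ↔
      φ.Sat (h.map (instSession y)) i (fun j => argVal y (ρ j)) := by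
  have hs : ∀ i, ∀ e ∈ h.getD (i - 1) ∅, ∀ u ∈ e.2, IsAffine n A fun x => argVal x u := by
    intro i
    rw [List.getD_eq_getElem?_getD]
    rcases hi : h[i - 1]? with _ | s
    · simp
    · exact hh s (List.mem_of_getElem? hi)
  induction φ generalizing i with
  | pred p ts =>
    simp only [Formula.Sat, session_map_instSession, mem_instSession]
    refine exists_congr fun u => and_congr_right fun hu => map_eq_map_iff_congr fun a ha t ht => ?_
    -- The summand `A` of `coeffBound` is there to cover the arguments in the history itself.
    have hA : IsAffine n (coeffBound A C) fun x => argVal x a := (hs i _ hu a ha).mono (by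
      have : A ≤ coeffBound A C := Nat.le_add_left _ _
      exact_mod_cast this)
    refine hxy.eq_iff_eq hA (Term.isAffine ?_ hρ)
    refine (encode_le_of_mem (List.mem_map_of_mem (f := Term.data) ht)).le.trans ?_
    rw [Formula.code, Encodable.encode_prod_val] at hφ
    exact (Nat.right_le_pair _ _).trans ((Nat.right_le_pair _ _).trans hφ)
  | rel R t u =>
    rw [Formula.code, Encodable.encode_prod_val, Encodable.encode_prod_val] at hφ
    have h1 := (Nat.right_le_pair _ _).trans ((Nat.right_le_pair _ _).trans hφ)
    have ht := Term.isAffine ((Nat.left_le_pair _ _).trans h1) hρ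
    have hu := Term.isAffine ((Nat.right_le_pair _ _).trans h1) hρ
    cases R
    · exact hxy.eq_iff_eq ht hu
    · exact hxy.le_iff_le ht hu
    · exact hxy.le_iff_le hu ht
  | and φ ψ ih1 ih2 =>
    have h1 := (Nat.right_le_pair _ _).trans hφ
    exact and_congr (ih1 ((Nat.left_le_pair _ _).trans h1) i ρ hρ)
      (ih2 ((Nat.right_le_pair _ _).trans h1) i ρ hρ)
  | neg φ ih =>
    exact not_congr (ih ((Nat.right_le_pair _ _).trans hφ) i ρ hρ)
  | prev φ ih =>
    exact and_congr_right fun _ => ih ((Nat.right_le_pair _ _).trans hφ) _ ρ hρ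
  | since φ ψ ih1 ih2 =>
    have h1 := (Nat.right_le_pair _ _).trans hφ
    simp only [Formula.Sat, ih1 ((Nat.left_le_pair _ _).trans h1) _ ρ hρ,
      ih2 ((Nat.right_le_pair _ _).trans h1) _ ρ hρ]
  | all p k φ ih =>
    simp only [Formula.Sat, session_map_instSession, forall_mem_instSession]
    -- Both quantifiers now run over the same `u`, and the environment extended by `u` again
    -- consists of arguments of `h`.
    refine forall_congr' fun u => forall_congr' fun hu => ?_
    have h1 := (Nat.right_le_pair _ _).trans ((Nat.right_le_pair _ _).trans
      ((Nat.right_le_pair _ _).trans hφ))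
    have happ : ∀ x : ℕ → ℤ, Fin.append (fun j => argVal x (ρ j)) (fun j => argVal x (u j)) =
        fun j => argVal x (Fin.append ρ u j) := by
      intro x
      ext j
      refine Fin.addCases (fun j => ?_) (fun j => ?_) j <;> simp
    rw [happ, happ]
    refine ih h1 i _ fun j => ?_
    refine Fin.addCases (fun j => ?_) (fun j => ?_) j
    · simpa using hρ j
    · simpa using hs i _ hu (u j) (List.mem_ofFn.2 ⟨j, rfl⟩)

/-! ### Reduction to bounded total assignments -/

theorem subst_eq_map_instSession (h : POHistory) (x : ℕ → ℤ) :
    h.subst (fun v => x v) = h.map (instSession x) := by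
  classical
  refine List.map_congr_left fun s hs => ?_
  unfold instSession
  convert Finset.image_congr (s := s) (f := fun e : POEvent => (e.1, e.2.map (Sum.elim id
    fun v => if hv : v ∈ h.vars then x v else 0))) (g := fun e => (e.1, e.2.map (argVal x))) ?_
  intro e he
  refine Prod.ext rfl (List.map_congr_left fun u hu => ?_)
  rcases u with c | v
  · rfl
  · have : v ∈ h.vars := ⟨s, hs, e, he, hu⟩
    simp [argVal, this]

theorem potentiallySatisfies_iff {h : POHistory} {i : ℕ} {ψ : Formula 0} :
    PotentiallySatisfies h i ψ ↔ ∃ x : ℕ → ℤ, Forces (h.map (instSession x)) i ψ := by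
  classical
  constructor
  · rintro ⟨σ, hσ⟩
    refine ⟨fun v => if hv : v ∈ h.vars then σ ⟨v, hv⟩ else 0, ?_⟩
    rw [← subst_eq_map_instSession]
    simpa using hσ
  · rintro ⟨x, hx⟩
    exact ⟨fun v => x v, by rwa [subst_eq_map_instSession]⟩

theorem adheres_iff {h : POHistory} {i : ℕ} {ψ : Formula 0} :
    Adheres h i ψ ↔ ¬ PotentiallySatisfies h i ψ.neg := by
  simp [Adheres, PotentiallySatisfies, Forces, Formula.Sat]

/-- A bound for the values of the variables that suffices to satisfy a formula of code `c` in a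
partially observable history with code `a`. -/
def searchBound (a c : ℕ) : ℕ :=
  modelBound (boundStep^[a + 1] (2 * coeffBound (a + 1) c)) (a + 1) (a + 1)

/-- The code of `l` dominates every variable name and constant in it, so one number bounds both the
dimension and the coefficients. -/
theorem isAffine_of_mem {l : List (List POEvent)} {s : POSession} (hs : s ∈ l.map List.toFinset)
    {e : POEvent} (he : e ∈ s) {u : POArg} (hu : u ∈ e.2) :
    IsAffine (Encodable.encode l + 1) (Encodable.encode l + 1 : ℕ) fun x => argVal x u := by
  obtain ⟨s, hsl, rfl⟩ := List.mem_map.1 hs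
  have h1 := encode_le_of_mem hsl
  have h2 := encode_le_of_mem (List.mem_toFinset.1 he)
  have h3 : Encodable.encode e.2 ≤ Encodable.encode e := by
    rw [Encodable.encode_prod_val]
    exact Nat.right_le_pair _ _
  have h4 := encode_le_of_mem hu
  rcases u with c | v
  · have h5 : Encodable.encode (Sum.inl c : POArg) = 2 * Encodable.encode c := rfl
    refine isAffine_const _ ((abs_le_encode c).trans ?_)
    have : Encodable.encode c ≤ Encodable.encode l + 1 := by omega
    exact_mod_cast this
  · have h5 : Encodable.encode (Sum.inr v : POArg) = 2 * v + 1 := rfl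
    exact isAffine_var (by omega) (by push_cast; omega)

theorem exists_bounded_assignment {l : List (List POEvent)} {i : ℕ} {ψ : Formula 0} {x : ℕ → ℤ}
    (hx : Forces ((l.map List.toFinset).map (instSession x)) i ψ) :
    ∃ y : ℕ → ℤ, Forces ((l.map List.toFinset).map (instSession y)) i ψ ∧
      (∀ v < Encodable.encode l + 1, |y v| ≤ (searchBound (Encodable.encode l) ψ.code : ℤ)) ∧
      ∀ v, Encodable.encode l + 1 ≤ v → y v = 0 := by
  set a := Encodable.encode l
  have hN : 1 ≤ 2 * coeffBound (a + 1) ψ.code := by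
    unfold coeffBound
    omega
  obtain ⟨y, h1, -, h2⟩ := exists_small_model (a + 1) hN le_rfl le_rfl x
  -- Forms in `a + 1` variables ignore later coordinates; setting these to zero makes the assignment
  -- finite data.
  have hy : ∀ v < a + 1, (if v < a + 1 then y v else 0) = y v := fun v hv => if_pos hv
  have h1 : SameSigns (a + 1) (2 * coeffBound (a + 1) ψ.code : ℕ) x
      fun v => if v < a + 1 then y v else 0 := fun b c hbc => by
    rw [h1 b c hbc, affine, affine,
      Finset.sum_congr rfl fun v hv => by rw [← hy v (Finset.mem_range.1 hv)]]
  refine ⟨fun v => if v < a + 1 then y v else 0, ?_, fun v hv => ?_, fun v hv => ?_⟩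
  rotate_left
  · simp only [hy v hv]
    exact h2 v hv
  · exact if_neg (not_lt.2 hv)
  have := Formula.sat_congr (h := l.map List.toFinset) (n := a + 1) (A := a + 1) (C := ψ.code)
    (fun s hs e he u hu => isAffine_of_mem hs he hu) (h1.mono (by push_cast; omega)) ψ le_rfl i
    Fin.elim0 (fun j => j.elim0)
  have e : ∀ x : ℕ → ℤ, (fun j : Fin 0 => argVal x (j.elim0 : POArg)) = Fin.elim0 :=
    fun x => funext fun j => j.elim0
  rw [e, e] at this
  exact this.1 hx

/-! ### Primitive recursive operations -/

/-- The lists of length at most `n` with entries in `A`. -/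
def boundedLists {α : Type*} (A : List α) (n : ℕ) : List (List α) :=
  (fun L => [] :: L.flatMap fun l => A.map fun a => a :: l)^[n] [[]]

theorem mem_boundedLists {α : Type*} {A l : List α} {n : ℕ} :
    l ∈ boundedLists A n ↔ l.length ≤ n ∧ ∀ a ∈ l, a ∈ A := by
  induction n generalizing l with
  | zero => simp +contextual [boundedLists]
  | succ n ih =>
    rw [boundedLists, Function.iterate_succ_apply', ← boundedLists]
    cases l with
    | nil => simp
    | cons b l =>
      simp [ih]
      tauto

section Primrec

variable {α β γ : Type*} [Primcodable α] [Primcodable β] [Primcodable γ]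

theorem primrecPred_exists_mem {L : α → List β} {R : α → β → Prop} (hL : Primrec L)
    (hR : PrimrecRel R) : PrimrecPred fun a => ∃ b ∈ L a, R a b :=
  (hR.swap.exists_mem_list).comp hL Primrec.id

theorem primrecPred_forall_mem {L : α → List β} {R : α → β → Prop} (hL : Primrec L)
    (hR : PrimrecRel R) : PrimrecPred fun a => ∀ b ∈ L a, R a b :=
  (hR.swap.forall_mem_list).comp hL Primrec.id

theorem primrecPred_mem {L : α → List β} {f : α → β} (hL : Primrec L) (hf : Primrec f) :
    PrimrecPred fun a => f a ∈ L a :=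
  (primrecPred_exists_mem (R := fun a b => b = f a) hL
    (Primrec.eq.comp Primrec.snd (hf.comp Primrec.fst))).of_eq fun a => by simp

theorem primrecPred_imp {p q : α → Prop} (hp : PrimrecPred p) (hq : PrimrecPred q) :
    PrimrecPred fun a => p a → q a :=
  (hp.not.or hq).of_eq fun a => by tauto

theorem primrecPred_nat_eq {f : α → ℕ} (hf : Primrec f) (k : ℕ) : PrimrecPred fun a => f a = k :=
  Primrec.eq.comp hf (Primrec.const k)

/-- Integer arithmetic is reduced to positive and negative parts, which are read off the encoding of
`n` as `2n` and of `-(n + 1)` as `2n + 1`. -/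
theorem primrec_toNat : Primrec Int.toNat := by
  have h : Primrec fun z : ℤ => if Encodable.encode z % 2 = 0 then Encodable.encode z / 2 else 0 :=
    Primrec.ite (primrecPred_nat_eq (Primrec.nat_mod.comp Primrec.encode (Primrec.const 2)) 0)
      (Primrec.nat_div.comp Primrec.encode (Primrec.const 2)) (Primrec.const 0)
  refine h.of_eq fun z => ?_
  rcases z with n | n
  · rw [Int.ofNat_eq_natCast, encode_int_natCast]
    simp
  · rw [encode_int_negSucc, if_neg (by omega)]
    rfl

theorem primrec_toNat_neg : Primrec fun z : ℤ => (-z).toNat := by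
  have h : Primrec fun z : ℤ =>
      if Encodable.encode z % 2 = 0 then 0 else Encodable.encode z / 2 + 1 :=
    Primrec.ite (primrecPred_nat_eq (Primrec.nat_mod.comp Primrec.encode (Primrec.const 2)) 0)
      (Primrec.const 0)
      (Primrec.succ.comp (Primrec.nat_div.comp Primrec.encode (Primrec.const 2)))
  refine h.of_eq fun z => ?_
  rcases z with n | n
  · rw [Int.ofNat_eq_natCast, encode_int_natCast, if_pos (by omega)]
    omega
  · rw [encode_int_negSucc, if_neg (by omega)]
    omega

theorem primrec_natCast_sub : Primrec₂ fun a b : ℕ => (a : ℤ) - b := by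
  have h : Primrec₂ fun a b : ℕ => if b ≤ a then 2 * (a - b) else 2 * (b - a) - 1 :=
    Primrec.ite (Primrec.nat_le.comp Primrec.snd Primrec.fst)
      (Primrec.nat_mul.comp (Primrec.const 2) Primrec.nat_sub)
      (Primrec.nat_sub.comp (Primrec.nat_mul.comp (Primrec.const 2) (Primrec.nat_sub.comp
        Primrec.snd Primrec.fst)) (Primrec.const 1))
  refine Primrec₂.encode_iff.1 (h.of_eq fun a b => ?_)
  split_ifs with hab
  · rw [show (a : ℤ) - b = (a - b : ℕ) by omega, encode_int_natCast]
  · rw [show (a : ℤ) - b = Int.negSucc (b - a - 1) by omega, encode_int_negSucc]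
    omega

theorem primrec_int_add : Primrec₂ fun a b : ℤ => a + b := by
  have h : Primrec₂ fun a b : ℤ =>
      ((a.toNat + b.toNat : ℕ) : ℤ) - ((-a).toNat + (-b).toNat : ℕ) :=
    primrec_natCast_sub.comp
      (Primrec.nat_add.comp (primrec_toNat.comp Primrec.fst) (primrec_toNat.comp Primrec.snd))
      (Primrec.nat_add.comp (primrec_toNat_neg.comp Primrec.fst)
        (primrec_toNat_neg.comp Primrec.snd))
  exact h.of_eq fun a b => by omega

theorem primrec_int_mul : Primrec₂ fun a b : ℤ => a * b := by
  have h : Primrec₂ fun a b : ℤ => ((a.toNat * b.toNat + (-a).toNat * (-b).toNat : ℕ) : ℤ) -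
      (a.toNat * (-b).toNat + (-a).toNat * b.toNat : ℕ) :=
    primrec_natCast_sub.comp
      (Primrec.nat_add.comp
        (Primrec.nat_mul.comp (primrec_toNat.comp Primrec.fst) (primrec_toNat.comp Primrec.snd))
        (Primrec.nat_mul.comp (primrec_toNat_neg.comp Primrec.fst)
          (primrec_toNat_neg.comp Primrec.snd)))
      (Primrec.nat_add.comp
        (Primrec.nat_mul.comp (primrec_toNat.comp Primrec.fst) (primrec_toNat_neg.comp Primrec.snd))
        (Primrec.nat_mul.comp (primrec_toNat_neg.comp Primrec.fst)
          (primrec_toNat.comp Primrec.snd)))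
  refine h.of_eq fun a b => ?_
  have e : ∀ a : ℤ, (a.toNat : ℤ) - (-a).toNat = a := fun a => by omega
  conv_rhs => rw [← e a, ← e b]
  push_cast
  ring

theorem primrec_int_le : PrimrecRel fun a b : ℤ => a ≤ b := by
  have h : PrimrecRel fun a b : ℤ => a.toNat + (-b).toNat ≤ b.toNat + (-a).toNat :=
    Primrec.nat_le.comp
      (Primrec.nat_add.comp (primrec_toNat.comp Primrec.fst) (primrec_toNat_neg.comp Primrec.snd))
      (Primrec.nat_add.comp (primrec_toNat.comp Primrec.snd) (primrec_toNat_neg.comp Primrec.fst))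
  exact h.of_eq fun a b => by omega

theorem primrec_boundedLists : Primrec₂ (boundedLists (α := α)) := by
  refine Primrec.nat_iterate Primrec.snd (Primrec.const [[]]) ?_
  refine Primrec.list_cons.comp (Primrec.const []) (Primrec.list_flatMap Primrec.snd ?_)
  refine Primrec.list_map (Primrec.fst.comp (Primrec.fst.comp Primrec.fst)) ?_
  exact Primrec.list_cons.comp Primrec.snd (Primrec.snd.comp Primrec.fst)

theorem primrec_factorial : Primrec Nat.factorial := by
  refine (Primrec.nat_rec₁ 1 (f := fun n r => (n + 1) * r)
    (Primrec.nat_mul.comp (Primrec.succ.comp Primrec.fst) Primrec.snd)).of_eq fun n => ?_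
  induction n with
  | zero => rfl
  | succ n ih => rw [Nat.factorial_succ, ← ih]

theorem primrec_boundStep : Primrec boundStep :=
  Primrec.nat_mul.comp (Primrec.const 4) (Primrec.nat_mul.comp primrec_factorial Primrec.id)

theorem primrec_coeffBound : Primrec₂ coeffBound :=
  Primrec.nat_add.comp (Primrec.nat_add.comp (Primrec.nat_mul.comp
    (Primrec.nat_mul.comp Primrec.snd Primrec.snd) Primrec.fst) Primrec.snd) Primrec.fst

theorem primrec_searchBound : Primrec₂ searchBound := by
  have hs : Primrec fun p : ℕ × ℕ => p.1 + 1 := Primrec.succ.comp Primrec.fst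
  have hT : Primrec fun p : ℕ × ℕ => boundStep^[p.1 + 1] (2 * coeffBound (p.1 + 1) p.2) :=
    Primrec.nat_iterate hs
      (Primrec.nat_mul.comp (Primrec.const 2) (primrec_coeffBound.comp hs Primrec.snd))
      (primrec_boundStep.comp Primrec.snd)
  exact Primrec.nat_iterate hs (Primrec.const 0) (Primrec.nat_mul.comp (hT.comp Primrec.fst)
    (Primrec.succ.comp (Primrec.nat_mul.comp (hs.comp Primrec.fst) Primrec.snd)))

/-- A list that contains all integers of absolute value at most `B`. -/
def smallInts (B : ℕ) : List ℤ := (List.range (2 * B + 1)).map (Denumerable.ofNat ℤ)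

theorem mem_smallInts {B : ℕ} {z : ℤ} (h : |z| ≤ (B : ℤ)) : z ∈ smallInts B := by
  refine List.mem_map.2 ⟨Encodable.encode z, List.mem_range.2 ?_, Denumerable.ofNat_encode z⟩
  rw [abs_le] at h
  rcases z with n | n
  · rw [Int.ofNat_eq_natCast] at *
    rw [encode_int_natCast]
    omega
  · rw [encode_int_negSucc]
    omega

theorem primrec_smallInts : Primrec smallInts :=
  Primrec.list_map (Primrec.list_range.comp (Primrec.succ.comp
    (Primrec.nat_mul.comp (Primrec.const 2) Primrec.id))) ((Primrec.ofNat ℤ).comp Primrec.snd)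

end Primrec

/-! ### A primitive recursive evaluator -/

/-- The data of a term, as in `Term.data`. -/
abbrev TermData := List (ℤ × ℕ) × ℤ

/-- The value of a term given by its data. -/
def evalData (ρ : List ℤ) (t : TermData) : ℤ :=
  t.1.foldr (fun m r => m.1 * ρ.getD m.2 0 + r) t.2

theorem evalData_data {n : ℕ} (t : Term n) (ρ : Fin n → ℤ) :
    evalData (List.ofFn ρ) t.data = t.eval ρ := by
  obtain ⟨l, c⟩ := t
  simp only [evalData, Term.data, Term.eval]
  induction l with
  | nil => simp
  | cons m l ih =>
    simp only [List.map_cons, List.foldr_cons, List.sum_cons, ih]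
    -- The variables of a `Term n` are in range, so the default 0 is never returned.
    rw [List.getD_eq_getElem _ _ (by simp), List.getElem_ofFn]
    ring

theorem primrec_evalData : Primrec₂ evalData := by
  have h : Primrec₂ fun (p : List ℤ × TermData) (x : (ℤ × ℕ) × ℤ) =>
      x.1.1 * p.1.getD x.1.2 0 + x.2 :=
    primrec_int_add.comp
      (primrec_int_mul.comp (Primrec.fst.comp (Primrec.fst.comp Primrec.snd))
        ((Primrec.list_getD 0).comp (Primrec.fst.comp Primrec.fst)
          (Primrec.snd.comp (Primrec.fst.comp Primrec.snd))))
      (Primrec.snd.comp Primrec.snd)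
  exact Primrec.list_foldr (Primrec.fst.comp Primrec.snd) (Primrec.snd.comp Primrec.snd) h

/-- A point of evaluation: a position in the history, and values for the free variables. -/
abbrev EvalPoint := ℕ × List ℤ

/-- A history, with its sessions as lists. -/
abbrev ListHistory := List (List Event)

/-- An uninterpreted predicate, given by its data, holds in the history. -/
def predHolds (h : ListHistory) (q : EvalPoint) (d : ℕ × List TermData) : Prop :=
  (d.1, d.2.map (evalData q.2)) ∈ h.getD (q.1 - 1) []

/-- A comparison, given by its data, holds. -/
def relHolds (q : EvalPoint) (d : ℕ × TermData × TermData) : Prop :=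
  d.1 = 0 ∧ evalData q.2 d.2.1 = evalData q.2 d.2.2 ∨
  d.1 = 1 ∧ evalData q.2 d.2.1 ≤ evalData q.2 d.2.2 ∨
  d.1 = 2 ∧ evalData q.2 d.2.2 ≤ evalData q.2 d.2.1

/-- `φ S ψ` holds at a point, where `L` and `L'` list the points that satisfy `φ` and `ψ`. -/
def sinceHolds (L L' : List EvalPoint) (q : EvalPoint) : Prop :=
  ∃ j ∈ List.range (q.1 + 1), 1 ≤ j ∧ (j, q.2) ∈ L' ∧
    ∀ k ∈ List.range (q.1 + 1), j < k → (k, q.2) ∈ L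

/-- `∀ (xₙ, …, xₙ₊ₖ) : p. φ` holds at a point, where `L` lists the points that satisfy `φ`. -/
def allHolds (h : ListHistory) (L : List EvalPoint) (p k : ℕ) (q : EvalPoint) : Prop :=
  ∀ e ∈ h.getD (q.1 - 1) [], e.1 = p ∧ e.2.length = k + 1 → (q.1, q.2 ++ e.2) ∈ L

/-- The formula with code `c` holds at the point `q`, where the `d`-th entry of `M` lists the points
that satisfy the formula with code `d`, for `d < c`. -/
def codeHolds (h : ListHistory) (M : List (List EvalPoint)) (c : ℕ) (q : EvalPoint) : Prop :=
  c.unpair.1 = 0 ∧ predHolds h q ((Encodable.decode c.unpair.2).getD default) ∨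
  c.unpair.1 = 1 ∧ relHolds q ((Encodable.decode c.unpair.2).getD default) ∨
  c.unpair.1 = 2 ∧ q ∈ M.getD c.unpair.2.unpair.1 [] ∧ q ∈ M.getD c.unpair.2.unpair.2 [] ∨
  c.unpair.1 = 3 ∧ ¬ q ∈ M.getD c.unpair.2 [] ∨
  c.unpair.1 = 4 ∧ 1 < q.1 ∧ (q.1 - 1, q.2) ∈ M.getD c.unpair.2 [] ∨
  c.unpair.1 = 5 ∧ sinceHolds (M.getD c.unpair.2.unpair.1 []) (M.getD c.unpair.2.unpair.2 []) q ∨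
  c.unpair.1 = 6 ∧ allHolds h (M.getD c.unpair.2.unpair.2.unpair.2 []) c.unpair.2.unpair.1
    c.unpair.2.unpair.2.unpair.1 q

section codeHolds

variable {h : ListHistory} {M : List (List EvalPoint)} {q : EvalPoint}

/-- On genuine codes decoding succeeds, so the `default` in `codeHolds` plays no role. -/
theorem codeHolds_pred {d : ℕ × List TermData} :
    codeHolds h M (Nat.pair 0 (Encodable.encode d)) q ↔ predHolds h q d := by
  simp only [codeHolds, Nat.unpair_pair, Encodable.encodek, Option.getD_some]
  simp

theorem codeHolds_rel {d : ℕ × TermData × TermData} :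
    codeHolds h M (Nat.pair 1 (Encodable.encode d)) q ↔ relHolds q d := by
  simp only [codeHolds, Nat.unpair_pair, Encodable.encodek, Option.getD_some]
  simp

theorem codeHolds_and {a b : ℕ} :
    codeHolds h M (Nat.pair 2 (Nat.pair a b)) q ↔ q ∈ M.getD a [] ∧ q ∈ M.getD b [] := by
  simp [codeHolds]

theorem codeHolds_neg {a : ℕ} : codeHolds h M (Nat.pair 3 a) q ↔ ¬ q ∈ M.getD a [] := by
  simp [codeHolds]

theorem codeHolds_prev {a : ℕ} :
    codeHolds h M (Nat.pair 4 a) q ↔ 1 < q.1 ∧ (q.1 - 1, q.2) ∈ M.getD a [] := by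
  simp [codeHolds]

theorem codeHolds_since {a b : ℕ} : codeHolds h M (Nat.pair 5 (Nat.pair a b)) q ↔
    sinceHolds (M.getD a []) (M.getD b []) q := by
  simp [codeHolds]

theorem codeHolds_all {p k a : ℕ} : codeHolds h M (Nat.pair 6 (Nat.pair p (Nat.pair k a))) q ↔
    allHolds h (M.getD a []) p k q := by
  simp [codeHolds]

end codeHolds

/-! ### Primitive recursiveness of the evaluator -/

section Primrec

variable {α : Type*} [Primcodable α] {h : α → ListHistory} {L L' : α → List EvalPoint}
  {q : α → EvalPoint}

theorem primrec_session (hh : Primrec h) (hq : Primrec q) :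
    Primrec fun a => (h a).getD ((q a).1 - 1) [] :=
  (Primrec.list_getD []).comp hh (Primrec.nat_sub.comp (Primrec.fst.comp hq) (Primrec.const 1))

theorem primrecPred_predHolds {d : α → ℕ × List TermData} (hh : Primrec h) (hq : Primrec q)
    (hd : Primrec d) : PrimrecPred fun a => predHolds (h a) (q a) (d a) :=
  primrecPred_mem (primrec_session hh hq) (Primrec.pair (Primrec.fst.comp hd)
    (Primrec.list_map (Primrec.snd.comp hd)
      (primrec_evalData.comp (Primrec.snd.comp (hq.comp Primrec.fst)) Primrec.snd)))

theorem primrecPred_relHolds {d : α → ℕ × TermData × TermData} (hq : Primrec q) (hd : Primrec d) :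
    PrimrecPred fun a => relHolds (q a) (d a) := by
  have h0 : Primrec fun a => (d a).1 := Primrec.fst.comp hd
  have h1 : Primrec fun a => evalData (q a).2 (d a).2.1 :=
    primrec_evalData.comp (Primrec.snd.comp hq) (Primrec.fst.comp (Primrec.snd.comp hd))
  have h2 : Primrec fun a => evalData (q a).2 (d a).2.2 :=
    primrec_evalData.comp (Primrec.snd.comp hq) (Primrec.snd.comp (Primrec.snd.comp hd))
  exact ((primrecPred_nat_eq h0 0).and (Primrec.eq.comp h1 h2)).or
    (((primrecPred_nat_eq h0 1).and (primrec_int_le.comp h1 h2)).or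
      ((primrecPred_nat_eq h0 2).and (primrec_int_le.comp h2 h1)))

theorem primrecPred_sinceHolds (hL : Primrec L) (hL' : Primrec L') (hq : Primrec q) :
    PrimrecPred fun a => sinceHolds (L a) (L' a) (q a) := by
  have hr : Primrec fun a => List.range ((q a).1 + 1) :=
    Primrec.list_range.comp (Primrec.succ.comp (Primrec.fst.comp hq))
  have hq2 : Primrec fun a => (q a).2 := Primrec.snd.comp hq
  refine primrecPred_exists_mem hr (PrimrecPred.and ?_ (PrimrecPred.and ?_ ?_))
  · exact Primrec.nat_le.comp (Primrec.const 1) Primrec.snd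
  · exact primrecPred_mem (hL'.comp Primrec.fst) (Primrec.pair Primrec.snd (hq2.comp Primrec.fst))
  · refine primrecPred_forall_mem (hr.comp Primrec.fst) (primrecPred_imp ?_ ?_)
    · exact Primrec.nat_lt.comp (Primrec.snd.comp Primrec.fst) Primrec.snd
    · exact primrecPred_mem (hL.comp (Primrec.fst.comp Primrec.fst))
        (Primrec.pair Primrec.snd (hq2.comp (Primrec.fst.comp Primrec.fst)))

theorem primrecPred_allHolds {p k : α → ℕ} (hh : Primrec h) (hL : Primrec L) (hp : Primrec p)
    (hk : Primrec k) (hq : Primrec q) :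
    PrimrecPred fun a => allHolds (h a) (L a) (p a) (k a) (q a) := by
  refine primrecPred_forall_mem (primrec_session hh hq)
    (primrecPred_imp (PrimrecPred.and ?_ ?_) ?_)
  · exact Primrec.eq.comp (Primrec.fst.comp Primrec.snd) (hp.comp Primrec.fst)
  · exact Primrec.eq.comp (Primrec.list_length.comp (Primrec.snd.comp Primrec.snd))
      (Primrec.succ.comp (hk.comp Primrec.fst))
  · exact primrecPred_mem (hL.comp Primrec.fst)
      (Primrec.pair (Primrec.fst.comp (hq.comp Primrec.fst))
        (Primrec.list_append.comp (Primrec.snd.comp (hq.comp Primrec.fst))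
          (Primrec.snd.comp Primrec.snd)))

theorem primrecPred_codeHolds {M : α → List (List EvalPoint)} {c : α → ℕ} (hh : Primrec h)
    (hM : Primrec M) (hc : Primrec c) (hq : Primrec q) :
    PrimrecPred fun a => codeHolds (h a) (M a) (c a) (q a) := by
  have ht : Primrec fun a => (c a).unpair.1 := Primrec.fst.comp (Primrec.unpair.comp hc)
  have hd : Primrec fun a => (c a).unpair.2 := Primrec.snd.comp (Primrec.unpair.comp hc)
  have hd1 := Primrec.fst.comp (Primrec.unpair.comp hd)
  have hd2 := Primrec.snd.comp (Primrec.unpair.comp hd)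
  have hd21 := Primrec.fst.comp (Primrec.unpair.comp hd2)
  have hd22 := Primrec.snd.comp (Primrec.unpair.comp hd2)
  have hget : ∀ {d : α → ℕ}, Primrec d → Primrec fun a => (M a).getD (d a) [] :=
    fun hd => (Primrec.list_getD []).comp hM hd
  have hdec : ∀ (δ : Type) [Primcodable δ] [Inhabited δ],
      Primrec fun a => ((Encodable.decode (c a).unpair.2 : Option δ).getD default) :=
    fun δ _ _ => Primrec.option_getD.comp (Primrec.decode.comp hd) (Primrec.const default)
  refine ((primrecPred_nat_eq ht 0).and (primrecPred_predHolds hh hq (hdec _))).or <|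
    ((primrecPred_nat_eq ht 1).and (primrecPred_relHolds hq (hdec _))).or <|
    ((primrecPred_nat_eq ht 2).and
      ((primrecPred_mem (hget hd1) hq).and (primrecPred_mem (hget hd2) hq))).or <|
    ((primrecPred_nat_eq ht 3).and (primrecPred_mem (hget hd) hq).not).or <|
    ((primrecPred_nat_eq ht 4).and ((Primrec.nat_lt.comp (Primrec.const 1)
      (Primrec.fst.comp hq)).and (primrecPred_mem (hget hd) (Primrec.pair
        (Primrec.nat_sub.comp (Primrec.fst.comp hq) (Primrec.const 1))
          (Primrec.snd.comp hq))))).or <|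
    ((primrecPred_nat_eq ht 5).and (primrecPred_sinceHolds (hget hd1) (hget hd2) hq)).or <|
    (primrecPred_nat_eq ht 6).and (primrecPred_allHolds hh (hget hd22) hd1 hd21 hq)

end Primrec

open Classical in
/-- The points in `U` that satisfy the formulae with codes less than `c`. -/
noncomputable def tables (h : ListHistory) (U : List EvalPoint) (c : ℕ) : List (List EvalPoint) :=
  (fun M => M ++ [U.filter fun q => codeHolds h M M.length q])^[c] []

theorem primrec_tables {α : Type*} [Primcodable α] {h : α → ListHistory} {U : α → List EvalPoint}
    {c : α → ℕ} (hh : Primrec h) (hU : Primrec U) (hc : Primrec c) :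
    Primrec fun a => tables (h a) (U a) (c a) := by
  classical
  refine Primrec.nat_iterate hc (Primrec.const []) (Primrec.list_append.comp Primrec.snd
    (Primrec.list_cons.comp ?_ (Primrec.const [])))
  have hR : PrimrecRel fun (q : EvalPoint) (p : α × List (List EvalPoint)) =>
      codeHolds (h p.1) p.2 p.2.length q :=
    primrecPred_codeHolds (hh.comp (Primrec.fst.comp Primrec.snd))
      (Primrec.snd.comp Primrec.snd) (Primrec.list_length.comp (Primrec.snd.comp Primrec.snd))
      Primrec.fst
  exact hR.listFilter.comp (hU.comp Primrec.fst) Primrec.id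

open Classical in
theorem tables_succ (h : ListHistory) (U : List EvalPoint) (c : ℕ) :
    tables h U (c + 1) = tables h U c ++
      [U.filter fun q => codeHolds h (tables h U c) (tables h U c).length q] :=
  Function.iterate_succ_apply' _ _ _

theorem length_tables (h : ListHistory) (U : List EvalPoint) (c : ℕ) :
    (tables h U c).length = c := by
  induction c with
  | zero => rfl
  | succ c ih => rw [tables_succ, List.length_append, ih, List.length_singleton]

/-- Entries are only appended, so entry `d` is fixed at stage `d`, when the table has length `d`. -/
theorem mem_getD_tables {h : ListHistory} {U : List EvalPoint} {c d : ℕ} (hd : d < c)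
    {q : EvalPoint} :
    q ∈ (tables h U c).getD d [] ↔ q ∈ U ∧ codeHolds h (tables h U d) d q := by
  classical
  induction c with
  | zero => omega
  | succ c ih =>
    rw [tables_succ]
    rcases Nat.lt_succ_iff_lt_or_eq.1 hd with hd | rfl
    · rw [List.getD_append _ _ _ _ (by rwa [length_tables]), ih hd]
    · rw [List.getD_append_right _ _ _ _ (by rw [length_tables])]
      simp [length_tables]

/-- The points of evaluation for formulae of code at most `K`. -/
def evalPoints (h : ListHistory) (K : ℕ) : List EvalPoint :=
  (List.range (h.length + 1)).flatMap fun i =>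
    (boundedLists (h.flatMap fun s => s.flatMap fun e => e.2) K).map fun l => (i, l)

theorem mem_evalPoints {h : ListHistory} {K i : ℕ} {l : List ℤ} :
    (i, l) ∈ evalPoints h K ↔
      i ≤ h.length ∧ l.length ≤ K ∧ ∀ z ∈ l, ∃ s ∈ h, ∃ e ∈ s, z ∈ e.2 := by
  simp only [evalPoints, List.mem_flatMap, List.mem_range, List.mem_map, mem_boundedLists,
    Prod.mk.injEq, Nat.lt_succ_iff]
  constructor
  · rintro ⟨i, hi, l, hl, rfl, rfl⟩
    exact ⟨hi, hl⟩
  · rintro ⟨hi, hl⟩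
    exact ⟨i, hi, l, hl, rfl, rfl⟩

theorem primrec_evalPoints : Primrec₂ evalPoints := by
  refine Primrec.list_flatMap (Primrec.list_range.comp
    (Primrec.succ.comp (Primrec.list_length.comp Primrec.fst))) ?_
  refine Primrec.list_map (primrec_boundedLists.comp ?_ (Primrec.snd.comp Primrec.fst))
    (Primrec.pair (Primrec.snd.comp Primrec.fst) Primrec.snd)
  exact Primrec.list_flatMap (Primrec.fst.comp Primrec.fst)
    (Primrec.list_flatMap Primrec.snd (Primrec.snd.comp Primrec.snd))

theorem mem_session_map_toFinset {h : ListHistory} {i : ℕ} {e : Event} :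
    e ∈ History.session (h.map List.toFinset) i ↔ e ∈ h.getD (i - 1) [] := by
  rw [History.session, show (∅ : Session) = ([] : List Event).toFinset from rfl, List.getD_map,
    List.mem_toFinset]

theorem mem_of_mem_getD {h : ListHistory} {i : ℕ} {e : Event} (he : e ∈ h.getD i []) :
    ∃ s ∈ h, e ∈ s := by
  rw [List.getD_eq_getElem?_getD] at he
  rcases hi : h[i]? with _ | s
  · simp [hi] at he
  · rw [hi] at he
    exact ⟨s, List.mem_of_getElem? hi, he⟩

/-- The evaluator is correct. -/
theorem codeHolds_tables_iff {h : ListHistory} {K : ℕ} {m : ℕ} (φ : Formula m)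
    (hK : m + φ.code ≤ K) {i : ℕ} (hi1 : 1 ≤ i) (hi : i ≤ h.length) (ρ : Fin m → ℤ)
    (hρ : ∀ z ∈ List.ofFn ρ, ∃ s ∈ h, ∃ e ∈ s, z ∈ e.2) :
    codeHolds h (tables h (evalPoints h K) φ.code) φ.code (i, List.ofFn ρ) ↔
      φ.Sat (h.map List.toFinset) i ρ := by
  induction φ generalizing i with
  | pred p ts =>
    rw [Formula.code, codeHolds_pred]
    simp [Formula.Sat, predHolds, mem_session_map_toFinset, Function.comp_def, evalData_data]
  | rel R t u =>
    rw [Formula.code, codeHolds_rel]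
    cases R <;> simp [Formula.Sat, relHolds, evalData_data, Cmp.code, Cmp.Holds]
  | @and m φ ψ ih1 ih2 =>
    -- A pair is at least the sum of its components, so the positive tag makes the codes of
    -- subformulae strictly smaller: their entries are already present.
    have h1 := Nat.add_le_pair 2 (Nat.pair φ.code ψ.code)
    have h2 := Nat.add_le_pair φ.code ψ.code
    rw [Formula.code] at hK ⊢
    have hU : (i, List.ofFn ρ) ∈ evalPoints h K :=
      mem_evalPoints.2 ⟨hi, by rw [List.length_ofFn]; omega, hρ⟩
    rw [codeHolds_and, Formula.Sat, ← ih1 (by omega) hi1 hi ρ hρ, ← ih2 (by omega) hi1 hi ρ hρ,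
      mem_getD_tables (by omega), mem_getD_tables (by omega)]
    simp only [hU, true_and]
  | @neg m φ ih =>
    have h1 := Nat.add_le_pair 3 φ.code
    rw [Formula.code] at hK ⊢
    have hU : (i, List.ofFn ρ) ∈ evalPoints h K :=
      mem_evalPoints.2 ⟨hi, by rw [List.length_ofFn]; omega, hρ⟩
    rw [codeHolds_neg, Formula.Sat, ← ih (by omega) hi1 hi ρ hρ, mem_getD_tables (by omega)]
    simp only [hU, true_and]
  | @prev m φ ih =>
    have h1 := Nat.add_le_pair 4 φ.code
    rw [Formula.code] at hK ⊢
    -- For `i = 1` this is position 0, which `evalPoints` includes for this reason; the guard `1 <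
    -- i` excludes it afterwards.
    have hU : (i - 1, List.ofFn ρ) ∈ evalPoints h K :=
      mem_evalPoints.2 ⟨by omega, by rw [List.length_ofFn]; omega, hρ⟩
    rw [codeHolds_prev, Formula.Sat, mem_getD_tables (by omega)]
    simp only [hU, true_and]
    exact and_congr_right fun h' => ih (by omega) (by omega) (by omega) ρ hρ
  | @since m φ ψ ih1 ih2 =>
    have h1 := Nat.add_le_pair 5 (Nat.pair φ.code ψ.code)
    have h2 := Nat.add_le_pair φ.code ψ.code
    rw [Formula.code] at hK ⊢
    have hU : ∀ j ≤ i, (j, List.ofFn ρ) ∈ evalPoints h K := fun j hj =>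
      mem_evalPoints.2 ⟨by omega, by rw [List.length_ofFn]; omega, hρ⟩
    rw [codeHolds_since, Formula.Sat]
    simp only [sinceHolds, List.mem_range, Nat.lt_succ_iff]
    have e1 : ∀ j, 1 ≤ j → j ≤ i → ((j, List.ofFn ρ) ∈ (tables h (evalPoints h K)
        (Nat.pair 5 (Nat.pair φ.code ψ.code))).getD φ.code [] ↔
          φ.Sat (h.map List.toFinset) j ρ) := fun j hj1 hj => by
      rw [mem_getD_tables (by omega), ← ih1 (by omega) hj1 (by omega) ρ hρ]
      simp only [hU j hj, true_and]
    have e2 : ∀ j, 1 ≤ j → j ≤ i → ((j, List.ofFn ρ) ∈ (tables h (evalPoints h K)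
        (Nat.pair 5 (Nat.pair φ.code ψ.code))).getD ψ.code [] ↔
          ψ.Sat (h.map List.toFinset) j ρ) := fun j hj1 hj => by
      rw [mem_getD_tables (by omega), ← ih2 (by omega) hj1 (by omega) ρ hρ]
      simp only [hU j hj, true_and]
    constructor
    · rintro ⟨j, hj, hj1, hψ, hφ⟩
      exact ⟨j, hj1, hj, (e2 j hj1 hj).1 hψ,
        fun k hk hk' => (e1 k (by omega) hk').1 (hφ k hk' hk)⟩
    · rintro ⟨j, hj1, hj, hψ, hφ⟩
      exact ⟨j, hj, hj1, (e2 j hj1 hj).2 hψ,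
        fun k hk' hk => (e1 k (by omega) hk').2 (hφ k hk hk')⟩
  | @all m p k φ ih =>
    -- The code is at least `6 + p + k + φ.code`, which leaves room for the `k + 1` new variables:
    -- `m + φ.code ≤ K` persists in the larger scope.
    have h1 := Nat.add_le_pair 6 (Nat.pair p (Nat.pair k φ.code))
    have h2 := Nat.add_le_pair p (Nat.pair k φ.code)
    have h3 := Nat.add_le_pair k φ.code
    rw [Formula.code] at hK ⊢
    rw [codeHolds_all, Formula.Sat]
    simp only [allHolds, mem_session_map_toFinset]
    have key : ∀ c : Fin (k + 1) → ℤ, ((p, List.ofFn c) : Event) ∈ h.getD (i - 1) [] →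
        ((i, List.ofFn ρ ++ List.ofFn c) ∈ (tables h (evalPoints h K)
          (Nat.pair 6 (Nat.pair p (Nat.pair k φ.code)))).getD φ.code [] ↔
            φ.Sat (h.map List.toFinset) i (Fin.append ρ c)) := fun c hc => by
      have hρc : ∀ z ∈ List.ofFn (Fin.append ρ c), ∃ s ∈ h, ∃ e ∈ s, z ∈ e.2 := by
        intro z hz
        rw [List.ofFn_fin_append, List.mem_append] at hz
        rcases hz with hz | hz
        · exact hρ z hz
        · obtain ⟨s, hs, he⟩ := mem_of_mem_getD hc
          exact ⟨s, hs, _, he, hz⟩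
      have hU : (i, List.ofFn (Fin.append ρ c)) ∈ evalPoints h K :=
        mem_evalPoints.2 ⟨hi, by rw [List.length_ofFn]; omega, hρc⟩
      rw [← ih (by omega) hi1 hi _ hρc, ← List.ofFn_fin_append, mem_getD_tables (by omega)]
      simp only [hU, true_and]
    constructor
    · intro H c hc
      exact (key c hc).1 (H _ hc ⟨rfl, by simp⟩)
    · rintro H ⟨p', l⟩ he ⟨rfl, hl⟩
      dsimp only at hl
      obtain ⟨c, rfl⟩ : ∃ c : Fin (k + 1) → ℤ, l = List.ofFn c := by
        refine ⟨fun j => l.get (j.cast hl.symm), ?_⟩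
        exact List.ext_getElem (by rw [List.length_ofFn, hl]) fun j _ _ => by
          rw [List.getElem_ofFn]
          rfl
      exact (key c he).2 (H c he)

/-! ### The decision procedure -/

/-- A partially observable history, with its sessions as lists, under the assignment given by a list
of values. -/
def instLists (l : List (List POEvent)) (s : List ℤ) : ListHistory :=
  l.map fun t => t.map fun e => (e.1, e.2.map (argVal fun v => s.getD v 0))

theorem map_toFinset_instLists (l : List (List POEvent)) (s : List ℤ) :
    (instLists l s).map List.toFinset =
      (l.map List.toFinset).map (instSession fun v => s.getD v 0) := by
  simp only [instLists, List.map_map]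
  refine List.map_congr_left fun t _ => ?_
  ext e
  simp [instSession]

theorem primrec_instLists : Primrec₂ instLists := by
  refine Primrec.list_map Primrec.fst (Primrec.list_map Primrec.snd
    (Primrec.pair (Primrec.fst.comp Primrec.snd) ?_))
  refine Primrec.list_map (Primrec.snd.comp Primrec.snd) ?_
  exact Primrec.sumCasesOn Primrec.snd Primrec.snd
    ((Primrec.list_getD 0).comp (Primrec.snd.comp (Primrec.fst.comp (Primrec.fst.comp
      (Primrec.fst.comp Primrec.fst)))) Primrec.snd)

/-- The candidates for a satisfying assignment. -/
def candidates (l : List (List POEvent)) (c : ℕ) : List (List ℤ) :=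
  boundedLists (smallInts (searchBound (Encodable.encode l) c)) (Encodable.encode l + 1)

theorem primrec_candidates : Primrec₂ candidates :=
  primrec_boundedLists.comp
    (primrec_smallInts.comp (primrec_searchBound.comp (Primrec.encode.comp Primrec.fst)
      Primrec.snd))
    (Primrec.succ.comp (Primrec.encode.comp Primrec.fst))

/-- The formula with code `c` holds at position `i` of the history. -/
def holdsAt (h : ListHistory) (i c : ℕ) : Prop :=
  (i, []) ∈ (tables h (evalPoints h c) (c + 1)).getD c []

theorem holdsAt_code_iff {h : ListHistory} {i : ℕ} {ψ : Formula 0} (hi1 : 1 ≤ i)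
    (hi : i ≤ h.length) : holdsAt h i ψ.code ↔ Forces (h.map List.toFinset) i ψ := by
  have := codeHolds_tables_iff (h := h) (K := ψ.code) ψ (by omega) hi1 hi Fin.elim0 (by simp)
  rw [holdsAt, mem_getD_tables (Nat.lt_succ_self _), Forces, ← this]
  have hU : (i, []) ∈ evalPoints h ψ.code := mem_evalPoints.2 ⟨hi, by simp, by simp⟩
  simp only [hU, true_and, List.ofFn_zero]

/-- Some candidate satisfies the formula with code `c` at position `i`. -/
def someCandidateHolds (a : List (List POEvent) × ℕ × ℕ) : Prop :=
  ∃ s ∈ candidates a.1 a.2.2, holdsAt (instLists a.1 s) a.2.1 a.2.2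

theorem primrecPred_someCandidateHolds : PrimrecPred someCandidateHolds := by
  have hc : Primrec fun a : List (List POEvent) × ℕ × ℕ => a.2.2 :=
    Primrec.snd.comp Primrec.snd
  have hl : Primrec fun p : (List (List POEvent) × ℕ × ℕ) × List ℤ => instLists p.1.1 p.2 :=
    primrec_instLists.comp (Primrec.fst.comp Primrec.fst) Primrec.snd
  refine primrecPred_exists_mem (primrec_candidates.comp Primrec.fst hc) ?_
  refine primrecPred_mem ((Primrec.list_getD []).comp
    (primrec_tables hl (primrec_evalPoints.comp hl (hc.comp Primrec.fst))
      (Primrec.succ.comp (hc.comp Primrec.fst))) (hc.comp Primrec.fst)) ?_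
  exact Primrec.pair (Primrec.fst.comp (Primrec.snd.comp Primrec.fst)) (Primrec.const [])

/-- Any successful candidate is itself a satisfying assignment; conversely
`exists_bounded_assignment` puts one among the candidates. -/
theorem someCandidateHolds_iff {l : List (List POEvent)} {i : ℕ} {ψ : Formula 0} (hi1 : 1 ≤ i)
    (hi : i ≤ l.length) :
    someCandidateHolds (l, i, ψ.code) ↔ PotentiallySatisfies (l.map List.toFinset) i ψ := by
  have key : ∀ s, holdsAt (instLists l s) i ψ.code ↔
      Forces ((l.map List.toFinset).map (instSession fun v => s.getD v 0)) i ψ := fun s => by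
    rw [holdsAt_code_iff hi1 (by rwa [instLists, List.length_map]), map_toFinset_instLists]
  rw [potentiallySatisfies_iff]
  constructor
  · rintro ⟨s, -, hs⟩
    exact ⟨_, (key s).1 hs⟩
  · rintro ⟨x, hx⟩
    obtain ⟨y, hy, hb, h0⟩ := exists_bounded_assignment hx
    refine ⟨(List.range (Encodable.encode l + 1)).map y, ?_, (key _).2 ?_⟩
    · refine mem_boundedLists.2 ⟨by simp, fun z hz => ?_⟩
      obtain ⟨v, hv, rfl⟩ := List.mem_map.1 hz
      exact mem_smallInts (hb v (List.mem_range.1 hv))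
    -- Past the end of the list `getD` returns 0, which is the value of `y` there.
    · convert hy using 3
      funext v
      rw [List.getD_eq_getElem?_getD, List.getElem?_map]
      rcases lt_or_ge v (Encodable.encode l + 1) with hv | hv
      · rw [List.getElem?_range hv]
        rfl
      · rw [List.getElem?_eq_none (by simpa using hv), h0 v hv]
        rfl

theorem decidableProblem_potentiallySatisfies : DecidableProblem PotentiallySatisfies := by
  obtain ⟨_, h⟩ := primrecPred_someCandidateHolds
  exact ⟨_, h.to_comp, fun l i ψ hi1 hi => by
    rw [decide_eq_true_iff, someCandidateHolds_iff hi1 hi]⟩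

theorem decidableProblem_adheres : DecidableProblem Adheres := by
  obtain ⟨f, hf, h⟩ := decidableProblem_potentiallySatisfies
  -- `Nat.pair 3` turns the code of a formula into that of its negation.
  refine ⟨fun a => !f (a.1, a.2.1, Nat.pair 3 a.2.2), ?_, fun l i ψ hi1 hi => ?_⟩
  · refine Primrec.not.to_comp.comp (hf.comp (Primrec.to_comp ?_))
    exact Primrec.pair Primrec.fst (Primrec.pair (Primrec.fst.comp Primrec.snd)
      (Primrec₂.natPair.comp (Primrec.const 3) (Primrec.snd.comp Primrec.snd)))
  · rw [adheres_iff, ← h l i ψ.neg hi1 hi]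
    simp [Formula.code]

end PTLTL

theorem theorem5 :
    PTLTL.DecidableProblem PTLTL.PotentiallySatisfies ∧
      PTLTL.DecidableProblem PTLTL.Adheres :=
  ⟨PTLTL.decidableProblem_potentiallySatisfies, PTLTL.decidableProblem_adheres⟩
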